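/- **Theorem.** Let $N\ge 2$ and let $\mathbf P_N$ be the path graph with vertices $S_1,\dots,S_N$ and edges $\{S_k,S_{k+1}\}$, $1\le k\le N-1$. Then the PIR capacity of $\mathbf P_N$ is $$\mathscr C(\mathbf P_N)=\frac 2N ,$$ and this value is attained by a PIR scheme with files of length $L=2$ bits. Here, for a finite simple graph $G$, the vertices are $N$ non-colluding servers and the edges are files: the file $W_e$ of an edge $e=\{S_i,S_j\}$ is stored on exactly the two servers $S_i,S_j$. The $K$ files are independent and uniformly distributed on $\mathbb F_2^L$, $L\ge 1$. A PIR scheme for $G$ with file length $L$ consists, for every desired file index $\theta\in[K]$, of (discrete) random queries $Q_1(\theta),\dots,Q_N(\theta)$, jointly independent of $(W_1,\dots,W_K)$, and of answers $A_1(\theta),\dots,A_N(\theta)$, where $A_i(\theta)$ is a function of $Q_i(\theta)$ and of the tuple $\mathcal W_i$ of the files stored on $S_i$ (for each server the same function for all $\theta$), such that * (reliability) for every $\theta$, the user, who knows $\theta$ and the queries, recovers $W_\theta$ from $A_1(\theta),\dots,A_N(\theta)$ with probability of error zero; * (privacy) for every $i$ and all $\theta,\theta'$, the triples $(Q_i(\theta),A_i(\theta),\mathcal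 W_i)$ and $(Q_i(\theta'),A_i(\theta'),\mathcal W_i)$ have the same distribution. The rate of the scheme is $L/\sum_{i=1}^N H(A_i(\theta))$, with $H$ the Shannon entropy in bits; by privacy it does not depend on $\theta$. The capacity $\mathscr C(G)$ is the supremum of the rates over all file lengths $L\ge1$ and all PIR schemes for $G$. -/

import Mathlib

open scoped ENNReal

noncomputable section

namespace GraphPIR

/-- A binary file of length `L`, i.e. a vector of `𝔽₂ ^ L`. -/
abbrev BinFile (L : ℕ) : Type := Fin L → ZMod 2

/-- Shannon entropy, in bits, of a discrete probability distribution. It takes values in `[0, ∞]`,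
as the distribution may have infinite support. -/
def entropy {α : Type*} (p : PMF α) : ℝ≥0∞ :=
  ∑' a, ENNReal.ofReal (Real.negMulLog (p a).toReal / Real.log 2)

/-- A retrieval scheme with files of `L` bits for the replication system of the graph `G`: the
vertices are the servers, and every edge `e` is a file, which is stored on the two endpoints of `e`.

All random variables are discrete and live on one probability space `(Ω, P)`. -/
structure RetrievalScheme {V : Type*} (G : SimpleGraph V) (L : ℕ) where
  /-- the sample space -/
  Ω : Type
  /-- the probability measure on `Ω` -/
  P : PMF Ω
  /-- the tuple `W` of all files -/
  file : Ω → G.edgeSet → BinFile L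
  /-- the files are independent and uniformly distributed on `𝔽₂ ^ L`, that is, the tuple of all
  files is uniformly distributed -/
  file_uniform : ∀ w : G.edgeSet → BinFile L,
    P.map file w = (Nat.card (G.edgeSet → BinFile L) : ℝ≥0∞)⁻¹
  /-- the set of possible queries to a server -/
  Query : V → Type
  /-- `query θ i` is the query `Q_i(θ)` to server `i` when the desired file is `θ` -/
  query : G.edgeSet → (i : V) → Ω → Query i
  /-- the tuple of all queries is independent of the files -/
  query_indep : ∀ (θ : G.edgeSet) (w : G.edgeSet → BinFile L) (q : ∀ i, Query i),
    P.map (fun ω => (file ω, fun i => query θ i ω)) (w, q) =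
      P.map file w * P.map (fun ω i => query θ i ω) q
  /-- the set of possible answers of a server -/
  Answer : V → Type
  /-- server `i` computes its answer from the query received and the files stored on it -/
  respond : (i : V) → Query i → ({e : G.edgeSet // i ∈ (e : Sym2 V)} → BinFile L) → Answer i

namespace RetrievalScheme

variable {V : Type*} {G : SimpleGraph V} {L : ℕ}

/-- The tuple `W_i` of the files stored on server `i`. -/
def stored (T : RetrievalScheme G L) (i : V) (ω : T.Ω) :
    {e : G.edgeSet // i ∈ (e : Sym2 V)} → BinFile L :=
  fun e => T.file ω e.1

/-- The answer `A_i(θ)` of server `i` when the desired file is `θ`. -/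
def answer (T : RetrievalScheme G L) (θ : G.edgeSet) (i : V) (ω : T.Ω) : T.Answer i :=
  T.respond i (T.query θ i ω) (T.stored i ω)

/-- Reliability: for every desired file `θ`, the user, who knows `θ` and the queries, recovers the
file from the answers with probability of error zero. -/
def IsReliable (T : RetrievalScheme G L) : Prop :=
  ∀ θ : G.edgeSet, ∃ decode : (∀ i, T.Query i) → (∀ i, T.Answer i) → BinFile L,
    ∀ ω ∈ T.P.support,
      decode (fun i => T.query θ i ω) (fun i => T.answer θ i ω) = T.file ω θ

/-- Privacy: for every server `i`, the joint distribution of `(Q_i(θ), A_i(θ), W_i)` does not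
depend on the desired file `θ`. -/
def IsPrivate (T : RetrievalScheme G L) : Prop :=
  ∀ (i : V) (θ θ' : G.edgeSet),
    T.P.map (fun ω => (T.query θ i ω, T.answer θ i ω, T.stored i ω)) =
      T.P.map (fun ω => (T.query θ' i ω, T.answer θ' i ω, T.stored i ω))

/-- The rate `L / ∑ i, H(A_i)`, for the desired file `θ`. -/
def rate [Fintype V] (T : RetrievalScheme G L) (θ : G.edgeSet) : ℝ≥0∞ :=
  (L : ℝ≥0∞) / ∑ i, entropy (T.P.map (T.answer θ i))

/-- The rate of a private scheme does not depend on the desired file. -/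
theorem IsPrivate.rate_eq [Fintype V] {T : RetrievalScheme G L} (hT : T.IsPrivate)
    (θ θ' : G.edgeSet) : T.rate θ = T.rate θ' := by
  have h : ∀ i, T.P.map (T.answer θ i) = T.P.map (T.answer θ' i) := by
    intro i
    have := congrArg (PMF.map fun x => x.2.1) (hT i θ θ')
    simpa only [PMF.map_comp, Function.comp_def] using this
  simp only [rate, h]

end RetrievalScheme

/-- The PIR capacity of a graph: the supremum of the rates of all reliable and private retrieval
schemes, over all file lengths `L ≥ 1`. -/
def capacity {V : Type*} [Fintype V] (G : SimpleGraph V) : ℝ≥0∞ :=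
  ⨆ (L : ℕ) (_ : 1 ≤ L) (T : RetrievalScheme G L) (_ : T.IsReliable) (_ : T.IsPrivate)
    (θ : G.edgeSet), T.rate θ

end GraphPIR

end

open scoped ENNReal

/-! Converse. Fix the queries: each answer becomes a function of the uniform tuple of files, so it
is a partition of a finite set, and entropies of answers become entropies of partitions. Averaging
over the queries gives at most `H(A_i)` (`mean_classEntropy_le`), and by privacy the average of a
function of one server's query does not depend on the desired file.

If `i` and `j` share a file, their answers together with all other files determine it, so `L ≤
H(A_i) + H(A_j)`. Pairing off servers settles even `N`. For odd `N` one block of three consecutive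
servers `i, j, k` remains, with `3L ≤ 2(H(A_i) + H(A_j) + H(A_k))` (`le_two_mul_entropy_add`). Let
`e`, `f` be its two edges, `R` the files other than `e, f`, and `R'` those other than `f`. When `e`
is desired, the three answers and `R` yield `R'`, which bounds `H(A_j, R')` and `H(A_k, R')` above.
When `f` is desired, submodularity bounds their sum below by `H(W) + H(R')`. Privacy identifies the
two situations.

Achievability (`pathScheme`). Each server sends one bit, a sum of one bit per stored file. Deleting
the desired edge cuts the path in two; on either side every other file is counted twice and cancels
modulo 2, so the two sides give the two bits of the desired file. -/

namespace GraphPIR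

/-! ### Entropy of partitions of a finite set, and its submodularity -/

section Ambiguity

variable {F : Type*} [Fintype F]

open Classical in
/-- The number of elements of the class of `w`. -/
noncomputable def classCard (r : Setoid F) (w : F) : ℕ :=
  (Finset.univ.filter fun u => r w u).card

theorem classCard_pos (r : Setoid F) (w : F) : 0 < classCard r w :=
  Finset.card_pos.2 ⟨w, by simp⟩

theorem classCard_congr (r : Setoid F) {w u : F} (h : r w u) : classCard r w = classCard r u := by
  unfold classCard
  congr 1
  ext v
  simp only [Finset.mem_filter, Finset.mem_univ, true_and]
  exact ⟨fun hv => r.trans (r.symm h) hv, fun hv => r.trans h hv⟩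

theorem classCard_mono {r s : Setoid F} (h : r ≤ s) (w : F) : classCard r w ≤ classCard s w :=
  Finset.card_le_card fun u hu => by
    simp only [Finset.mem_filter, Finset.mem_univ, true_and] at hu ⊢
    exact h hu

open Classical in
theorem classCard_eq_sum (r : Setoid F) (w : F) :
    (classCard r w : ℝ) = ∑ u, if r w u then 1 else 0 := by
  rw [classCard, Finset.sum_boole]

-- The `w` that contribute for fixed `u, v` lie in a single class of `r ⊓ s ⊓ t`. The summand is
-- constant on that class, and its first denominator cancels the size of the class.
open Classical in
theorem sum_common_class_le (r s t : Setoid F) (u v : F) :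
    ∑ w, (if (r ⊓ t) w u then (1 : ℝ) else 0) * (if (s ⊓ t) w v then 1 else 0) /
        (classCard (r ⊓ s ⊓ t) w * classCard t w) ≤
      (if t u v then 1 else 0) / classCard t u := by
  by_cases h : ∃ w, (r ⊓ t) w u ∧ (s ⊓ t) w v
  · obtain ⟨w₀, ⟨h₁, h₂⟩, h₃, h₄⟩ := h
    have hc := classCard_pos (r ⊓ s ⊓ t) w₀
    have hle : ∀ w, (if (r ⊓ t) w u then (1 : ℝ) else 0) * (if (s ⊓ t) w v then 1 else 0) /
        (classCard (r ⊓ s ⊓ t) w * classCard t w) ≤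
        (if (r ⊓ s ⊓ t) w₀ w then 1 else 0) * (1 / (classCard (r ⊓ s ⊓ t) w₀ * classCard t u)) := by
      intro w
      by_cases hw : (r ⊓ t) w u ∧ (s ⊓ t) w v
      · obtain ⟨h, h'⟩ := hw
        have hw₀ : (r ⊓ s ⊓ t) w₀ w :=
          ⟨⟨r.trans h₁ (r.symm h.1), s.trans h₃ (s.symm h'.1)⟩, t.trans h₂ (t.symm h.2)⟩
        rw [if_pos h, if_pos h', if_pos hw₀, ← classCard_congr _ hw₀, classCard_congr t h.2]
        simp
      · have : (if (r ⊓ t) w u then (1 : ℝ) else 0) * (if (s ⊓ t) w v then 1 else 0) = 0 := by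
          rcases not_and_or.1 hw with h | h <;> simp [h]
        rw [this, zero_div]
        positivity
    refine (Finset.sum_le_sum fun w _ => hle w).trans ?_
    rw [← Finset.sum_mul, ← classCard_eq_sum, if_pos (t.trans (t.symm h₂) h₄)]
    have : (classCard (r ⊓ s ⊓ t) w₀ : ℝ) ≠ 0 := by exact_mod_cast hc.ne'
    rw [← mul_one_div_cancel this]
    apply le_of_eq
    field_simp
  · rw [Finset.sum_eq_zero]
    · positivity
    · intro w _
      have : (if (r ⊓ t) w u then (1 : ℝ) else 0) * (if (s ⊓ t) w v then 1 else 0) = 0 := by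
        rcases not_and_or.1 (not_exists.1 h w) with h | h <;> simp [h]
      rw [this, zero_div]

/-- Expanding the numerator counts pairs `(u, v)` of companions of `w`; exchanging the sums reduces
to the bound for a fixed pair. -/
theorem sum_classCard_ratio_le (r s t : Setoid F) :
    ∑ w, (classCard (r ⊓ t) w * classCard (s ⊓ t) w : ℝ) /
      (classCard (r ⊓ s ⊓ t) w * classCard t w) ≤ Fintype.card F := by
  classical
  calc _ = ∑ w, ∑ u, ∑ v, (if (r ⊓ t) w u then (1 : ℝ) else 0) *
          (if (s ⊓ t) w v then 1 else 0) / (classCard (r ⊓ s ⊓ t) w * classCard t w) := by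
        refine Finset.sum_congr rfl fun w _ => ?_
        rw [classCard_eq_sum (r ⊓ t), classCard_eq_sum (s ⊓ t), Finset.sum_mul_sum,
          Finset.sum_div]
        simp only [Finset.sum_div]
    _ = ∑ u, ∑ v, ∑ w, (if (r ⊓ t) w u then (1 : ℝ) else 0) *
          (if (s ⊓ t) w v then 1 else 0) / (classCard (r ⊓ s ⊓ t) w * classCard t w) := by
        rw [Finset.sum_comm]
        exact Finset.sum_congr rfl fun u _ => Finset.sum_comm
    _ ≤ ∑ u, ∑ v, (if t u v then (1 : ℝ) else 0) / classCard t u :=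
        Finset.sum_le_sum fun u _ => Finset.sum_le_sum fun v _ => sum_common_class_le r s t u v
    _ = ∑ _u : F, (1 : ℝ) := by
        refine Finset.sum_congr rfl fun u _ => ?_
        have : (classCard t u : ℝ) ≠ 0 := by exact_mod_cast (classCard_pos t u).ne'
        rw [← Finset.sum_div, ← classCard_eq_sum, div_self this]
    _ = Fintype.card F := by simp

/-- The conditional entropy, in bits, of a uniformly distributed element of `F` given its class. -/
noncomputable def ambiguity (r : Setoid F) : ℝ :=
  (∑ w, Real.logb 2 (classCard r w)) / Fintype.card F

theorem ambiguity_mono {r s : Setoid F} (h : r ≤ s) : ambiguity r ≤ ambiguity s := by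
  unfold ambiguity
  gcongr with w
  · norm_num
  · exact_mod_cast classCard_pos r w
  · exact classCard_mono h w

/-- Submodularity: a finer setoid carries more information and `⊓` is joint information. It follows
from `log x ≤ x - 1` applied to the ratio of class sizes, whose mean is at most 1. -/
theorem ambiguity_inf_add_le (r s t : Setoid F) :
    ambiguity (r ⊓ t) + ambiguity (s ⊓ t) ≤ ambiguity (r ⊓ s ⊓ t) + ambiguity t := by
  have hlog : 0 < Real.log 2 := Real.log_pos one_lt_two
  have hpos : ∀ (q : Setoid F) w, (0 : ℝ) < classCard q w := fun q w => by
    exact_mod_cast classCard_pos q w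
  have key : ∀ w, Real.logb 2 (classCard (r ⊓ t) w) + Real.logb 2 (classCard (s ⊓ t) w) -
      (Real.logb 2 (classCard (r ⊓ s ⊓ t) w) + Real.logb 2 (classCard t w)) ≤
      ((classCard (r ⊓ t) w * classCard (s ⊓ t) w : ℝ) /
        (classCard (r ⊓ s ⊓ t) w * classCard t w) - 1) / Real.log 2 := by
    intro w
    have h₁ := hpos (r ⊓ t) w
    have h₂ := hpos (s ⊓ t) w
    have h₃ := hpos (r ⊓ s ⊓ t) w
    have h₄ := hpos t w
    rw [← Real.logb_mul h₁.ne' h₂.ne', ← Real.logb_mul h₃.ne' h₄.ne',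
      ← Real.logb_div (by positivity) (by positivity), Real.logb]
    gcongr
    exact Real.log_le_sub_one_of_pos (by positivity)
  have hsum := Finset.sum_le_sum fun w (_ : w ∈ Finset.univ) => key w
  rw [← Finset.sum_div, Finset.sum_sub_distrib, Finset.sum_sub_distrib, Finset.sum_add_distrib,
    Finset.sum_add_distrib] at hsum
  have h0 := sum_classCard_ratio_le r s t
  have : (∑ w, (classCard (r ⊓ t) w * classCard (s ⊓ t) w : ℝ) /
      (classCard (r ⊓ s ⊓ t) w * classCard t w) - ∑ _w : F, (1 : ℝ)) / Real.log 2 ≤ 0 := by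
    apply div_nonpos_of_nonpos_of_nonneg _ hlog.le
    simpa using h0
  unfold ambiguity
  rw [← add_div, ← add_div]
  exact div_le_div_of_nonneg_right (by linarith) (by positivity)

theorem ambiguity_bot : ambiguity (⊥ : Setoid F) = 0 := by
  have : ∀ w : F, classCard ⊥ w = 1 := by
    intro w
    rw [classCard, Finset.card_eq_one]
    exact ⟨w, by ext u; simp [Setoid.bot_def, eq_comm]⟩
  simp [ambiguity, this]

/-- The entropy, in bits, of the class of a uniformly distributed element of `F`. -/
noncomputable def classEntropy (r : Setoid F) : ℝ := ambiguity (⊤ : Setoid F) - ambiguity r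

theorem classEntropy_nonneg (r : Setoid F) : 0 ≤ classEntropy r :=
  sub_nonneg.2 (ambiguity_mono le_top)

theorem classEntropy_anti {r s : Setoid F} (h : r ≤ s) : classEntropy s ≤ classEntropy r :=
  sub_le_sub_left (ambiguity_mono h) _

theorem classEntropy_inf_add_le (r s t : Setoid F) :
    classEntropy (r ⊓ s ⊓ t) + classEntropy t ≤ classEntropy (r ⊓ t) + classEntropy (s ⊓ t) := by
  have := ambiguity_inf_add_le r s t
  unfold classEntropy
  linarith

theorem classEntropy_top : classEntropy (⊤ : Setoid F) = 0 := sub_self _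

theorem classEntropy_inf_le (r s : Setoid F) :
    classEntropy (r ⊓ s) ≤ classEntropy r + classEntropy s := by
  simpa [classEntropy_top] using classEntropy_inf_add_le r s ⊤

theorem classEntropy_bot_sub (r : Setoid F) :
    classEntropy (⊥ : Setoid F) - classEntropy r = ambiguity r := by
  simp [classEntropy, ambiguity_bot]

end Ambiguity

/-! ### The information in all files outside a given set -/

section Known

variable {E : Type*} {X : Type*}

/-- Two families are related if they agree outside `S`. -/
def agreeOff (X : Type*) (S : Set E) : Setoid (E → X) where
  r w u := ∀ e ∉ S, w e = u e
  iseqv := ⟨fun _ _ _ => rfl, fun h e he => (h e he).symm,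
    fun h h' e he => (h e he).trans (h' e he)⟩

/-- The coordinates in `S` are free and the others are fixed, so all classes have the same size. -/
theorem ambiguity_agreeOff [Finite E] [Fintype (E → X)] [Fintype X] [Nonempty X] (S : Set E) :
    ambiguity (agreeOff X S) = S.ncard * Real.logb 2 (Fintype.card X) := by
  classical
  have hc : ∀ w : E → X, classCard (agreeOff X S) w = Fintype.card X ^ S.ncard := by
    intro w
    have e : {u : E → X // agreeOff X S w u} ≃ (S → X) :=
      { toFun := fun u e => u.1 e
        invFun := fun x => ⟨fun e => if h : e ∈ S then x ⟨e, h⟩ else w e,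
          fun e he => by simp [he]⟩
        left_inv := by
          rintro ⟨u, hu⟩
          ext e
          by_cases he : e ∈ S
          · simp [he]
          · simpa [he] using hu e he
        right_inv := fun x => by ext e; simp }
    rw [classCard, ← Fintype.card_subtype, ← Nat.card_eq_fintype_card, Nat.card_congr e,
      Nat.card_fun, Nat.card_eq_fintype_card, ← Nat.card_coe_set_eq]
  have h0 : (Fintype.card (E → X) : ℝ) ≠ 0 := by
    exact_mod_cast Fintype.card_ne_zero
  simp only [ambiguity, hc, Finset.sum_const, Finset.card_univ, nsmul_eq_mul, Nat.cast_pow,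
    Real.logb_pow]
  field_simp

end Known

/-! ### Shannon entropy: concavity and comparison with partitions -/

section Entropy

/-- The tangent to `negMulLog` at `y` lies above the graph. The terms are arranged without
subtraction so that the bound can be summed in `ℝ≥0∞`. -/
theorem ofReal_negMulLog_add_le {x y : ℝ} (hx : 0 ≤ x) (hx1 : x ≤ 1) (hy : 0 < y) (hy1 : y ≤ 1) :
    ENNReal.ofReal (Real.negMulLog x) + ENNReal.ofReal x ≤
      ENNReal.ofReal x * ENNReal.ofReal (-Real.log y) + ENNReal.ofReal y := by
  have hlog : 0 ≤ -Real.log y := neg_nonneg.2 (Real.log_nonpos hy.le hy1)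
  have key : Real.negMulLog x + x ≤ x * (-Real.log y) + y := by
    rcases hx.eq_or_lt with rfl | hx
    · simpa using hy.le
    · have h := mul_le_mul_of_nonneg_left (Real.log_le_sub_one_of_pos (div_pos hy hx)) hx.le
      rw [Real.log_div hy.ne' hx.ne', mul_sub, mul_sub, mul_one, mul_div_cancel₀ _ hx.ne'] at h
      rw [Real.negMulLog]
      linarith
  rw [← ENNReal.ofReal_mul hx, ← ENNReal.ofReal_add (by positivity) hy.le]
  rw [← ENNReal.ofReal_add (Real.negMulLog_nonneg hx hx1) hx]
  exact ENNReal.ofReal_le_ofReal key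

theorem tsum_mul_negMulLog_le {β : Type*} (p : PMF β) (x : β → ℝ≥0∞) (hx : ∀ b, x b ≤ 1) :
    ∑' b, p b * ENNReal.ofReal (Real.negMulLog (x b).toReal) ≤
      ENNReal.ofReal (Real.negMulLog (∑' b, p b * x b).toReal) := by
  set Y := ∑' b, p b * x b with hY
  have hY1 : Y ≤ 1 := by
    rw [hY, ← p.tsum_coe]
    exact ENNReal.tsum_le_tsum fun b => mul_le_of_le_one_right' (hx b)
  have hYt : Y ≠ ∞ := ne_top_of_le_ne_top ENNReal.one_ne_top hY1
  have hxt : ∀ b, x b ≠ ∞ := fun b => ne_top_of_le_ne_top ENNReal.one_ne_top (hx b)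
  by_cases h0 : Y = 0
  · have h : ∀ b, p b * x b = 0 := ENNReal.tsum_eq_zero.1 h0
    refine le_of_eq_of_le (ENNReal.tsum_eq_zero.2 fun b => ?_) zero_le
    rcases mul_eq_zero.1 (h b) with h | h <;> simp [h]
  · have hy : 0 < Y.toReal := ENNReal.toReal_pos h0 hYt
    have hy1 : Y.toReal ≤ 1 := ENNReal.toReal_le_of_le_ofReal zero_le_one (by simpa using hY1)
    -- Jensen's inequality by averaging the tangent bound at the mean `Y`; both sides then contain
    -- the finite summand `Y`, which cancels.
    have hsum : ∑' b, p b * (ENNReal.ofReal (Real.negMulLog (x b).toReal) + x b) ≤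
        ∑' b, p b * (x b * ENNReal.ofReal (-Real.log Y.toReal) + Y) := by
      refine ENNReal.tsum_le_tsum fun b => ?_
      gcongr p b * ?_
      simpa only [ENNReal.ofReal_toReal (hxt b), ENNReal.ofReal_toReal hYt] using
        ofReal_negMulLog_add_le (x := (x b).toReal) ENNReal.toReal_nonneg
          (ENNReal.toReal_le_of_le_ofReal zero_le_one (by simpa using hx b)) hy hy1
    simp only [mul_add, ENNReal.tsum_add, ← mul_assoc, ENNReal.tsum_mul_right, p.tsum_coe,
      one_mul, ← hY] at hsum
    refine ((ENNReal.add_le_add_iff_right hYt).1 hsum).trans (le_of_eq ?_)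
    conv_lhs => rw [← ENNReal.ofReal_toReal hYt]
    rw [ENNReal.toReal_ofReal hy.le, ← ENNReal.ofReal_mul hy.le, Real.negMulLog]
    congr 1
    ring

theorem entropy_eq_div {α : Type*} (p : PMF α) :
    entropy p = (∑' a, ENNReal.ofReal (Real.negMulLog (p a).toReal)) /
      ENNReal.ofReal (Real.log 2) := by
  simp only [entropy, ENNReal.ofReal_div_of_pos (Real.log_pos one_lt_two)]
  simp only [div_eq_mul_inv, ENNReal.tsum_mul_right]

/-- Conditioning does not increase entropy. -/
theorem tsum_mul_entropy_le {α β : Type*} (p : PMF β) (κ : β → PMF α) :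
    ∑' b, p b * entropy (κ b) ≤ entropy (p.bind κ) := by
  simp only [entropy_eq_div, div_eq_mul_inv, ← mul_assoc, ENNReal.tsum_mul_right,
    ← ENNReal.tsum_mul_left]
  gcongr
  rw [ENNReal.tsum_comm]
  exact ENNReal.tsum_le_tsum fun a => tsum_mul_negMulLog_le p (fun b => κ b a)
    fun b => (κ b).coe_le_one a

theorem classEntropy_eq {F : Type*} [Fintype F] [Nonempty F] (r : Setoid F) :
    classEntropy r = ∑ w, (Fintype.card F : ℝ)⁻¹ *
      (-Real.logb 2 (classCard r w / Fintype.card F)) := by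
  have h0 : (Fintype.card F : ℝ) ≠ 0 := by exact_mod_cast Fintype.card_ne_zero
  have htop : ∀ w : F, classCard ⊤ w = Fintype.card F := fun w => by
    rw [classCard, ← Finset.card_univ]
    congr 1
    ext u
    simp [Setoid.top_def]
  have hc : ∀ w, (classCard r w : ℝ) ≠ 0 := fun w => by exact_mod_cast (classCard_pos r w).ne'
  simp only [classEntropy, ambiguity, htop, Real.logb_div (hc _) h0, neg_sub, ← Finset.mul_sum,
    Finset.sum_sub_distrib]
  field_simp

/-- The fibres of `f` are the classes of its kernel, so grouping the sum over `F` by values of `f`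
gives the entropy of the law. -/
theorem entropy_map_uniform {α F : Type*} [Fintype F] [Nonempty F] (f : F → α) :
    entropy ((PMF.uniformOfFintype F).map f) = ENNReal.ofReal (classEntropy (Setoid.ker f)) := by
  classical
  have h0 : (Fintype.card F : ℝ) ≠ 0 := by exact_mod_cast Fintype.card_ne_zero
  have hp : ∀ a, ((PMF.uniformOfFintype F).map f a).toReal =
      ((Finset.univ.filter fun w => f w = a).card : ℝ) / Fintype.card F := by
    intro a
    rw [PMF.map_apply, tsum_fintype]
    simp only [PMF.uniformOfFintype_apply, eq_comm (a := a)]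
    rw [← Finset.sum_filter, Finset.sum_const, nsmul_eq_mul]
    simp [div_eq_mul_inv]
  have hcard : ∀ w, classCard (Setoid.ker f) w = (Finset.univ.filter fun u => f u = f w).card := by
    intro w
    rw [classCard]
    congr 1
    ext u
    simp [Setoid.ker_def, eq_comm]
  rw [classEntropy_eq]
  simp only [hcard]
  rw [Finset.sum_comp (fun a => (Fintype.card F : ℝ)⁻¹ * (-Real.logb 2
    ((Finset.univ.filter fun u => f u = a).card / Fintype.card F))) f, entropy,
    ENNReal.ofReal_sum_of_nonneg, tsum_eq_sum (s := Finset.univ.image f)]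
  · refine Finset.sum_congr rfl fun a _ => ?_
    rw [hp, Real.negMulLog, Real.logb, nsmul_eq_mul]
    congr 1
    field_simp
  · intro a ha
    have : (Finset.univ.filter fun w => f w = a) = ∅ := by
      ext w
      simp only [Finset.mem_image, Finset.mem_univ, true_and, not_exists] at ha
      simp [ha w]
    rw [hp, this]
    simp
  · intro a _
    have h1 : ((Finset.univ.filter fun u => f u = a).card : ℝ) / Fintype.card F ≤ 1 := by
      refine div_le_one_of_le₀ ?_ (by positivity)
      exact_mod_cast Finset.card_le_univ _
    have := Real.logb_nonpos one_lt_two (by positivity) h1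
    have h2 := neg_nonneg.2 this
    positivity

theorem entropy_le_one (p : PMF (ZMod 2)) : entropy p ≤ 1 := by
  have hsum : (p 0).toReal + (p 1).toReal = 1 := by
    rw [← ENNReal.toReal_add (p.apply_ne_top 0) (p.apply_ne_top 1)]
    have := p.tsum_coe
    rw [tsum_fintype, show (Finset.univ : Finset (ZMod 2)) = {0, 1} from rfl,
      Finset.sum_pair zero_ne_one] at this
    rw [this, ENNReal.toReal_one]
  have hlog : 0 < Real.log 2 := Real.log_pos one_lt_two
  have h0 := Real.negMulLog_nonneg (x := (p 0).toReal) (by positivity) (by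
    linarith [ENNReal.toReal_nonneg (a := p 1)])
  have h1 := Real.negMulLog_nonneg (x := (p 1).toReal) (by positivity) (by
    linarith [ENNReal.toReal_nonneg (a := p 0)])
  rw [entropy_eq_div, tsum_fintype, show (Finset.univ : Finset (ZMod 2)) = {0, 1} from rfl,
    Finset.sum_pair zero_ne_one, ← ENNReal.ofReal_add h0 h1, ← ENNReal.ofReal_div_of_pos hlog]
  refine ENNReal.ofReal_le_one.2 ((div_le_one hlog).2 ?_)
  have := Real.binEntropy_le_log_two (p := (p 0).toReal)
  rwa [Real.binEntropy_eq_negMulLog_add_negMulLog_one_sub,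
    show 1 - (p 0).toReal = (p 1).toReal by linarith] at this

end Entropy

/-! ### Laws of independent pairs, and means -/

section Laws

theorem bind_map_prodMk_apply {α β : Type*} (p : PMF α) (q : PMF β) (a : α) (b : β) :
    (p.bind fun a => q.map (Prod.mk a)) (a, b) = p a * q b := by
  classical
  have h : ∀ a', (q.map (Prod.mk a')) (a, b) = if a = a' then q b else 0 := by
    intro a'
    rw [PMF.map_apply]
    refine (tsum_eq_single b fun b' hb => if_neg fun h => hb (Prod.ext_iff.1 h).2.symm).trans ?_
    simp
  rw [PMF.bind_apply, tsum_eq_single a fun a' ha => by rw [h, if_neg (Ne.symm ha), mul_zero], h,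
    if_pos rfl]

theorem tsum_map_mul {α β : Type*} (p : PMF α) (g : α → β) (f : β → ℝ≥0∞) :
    ∑' b, p.map g b * f b = ∑' a, p a * f (g a) := by
  classical
  simp only [PMF.map_apply, ← ENNReal.tsum_mul_right]
  rw [ENNReal.tsum_comm]
  refine tsum_congr fun a => ?_
  rw [tsum_eq_single (g a) fun b hb => by rw [if_neg hb, zero_mul], if_pos rfl]

theorem uniformOfFintype_map_equiv {α : Type*} [Fintype α] [Nonempty α] (e : α ≃ α) :
    (PMF.uniformOfFintype α).map e = PMF.uniformOfFintype α := by
  classical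
  ext a
  rw [PMF.map_apply, tsum_eq_single (e.symm a) fun b hb => if_neg fun h => hb (by simp [h])]
  simp

end Laws

/-- The mean of a nonnegative function. -/
noncomputable def mean {α : Type*} (p : PMF α) (f : α → ℝ≥0∞) : ℝ≥0∞ := ∑' a, p a * f a

theorem mean_add {α : Type*} (p : PMF α) (f g : α → ℝ≥0∞) :
    mean p (fun a => f a + g a) = mean p f + mean p g := by
  simp only [mean, mul_add, ENNReal.tsum_add]

theorem mean_const {α : Type*} (p : PMF α) (c : ℝ≥0∞) : mean p (fun _ => c) = c := by
  simp only [mean, ENNReal.tsum_mul_right, p.tsum_coe, one_mul]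

theorem mean_mono {α : Type*} (p : PMF α) {f g : α → ℝ≥0∞} (h : ∀ a ∈ p.support, f a ≤ g a) :
    mean p f ≤ mean p g := by
  refine ENNReal.tsum_le_tsum fun a => ?_
  by_cases ha : p a = 0
  · simp [ha]
  · exact mul_le_mul_right (h a ha) _

/-! ### Answers for fixed queries -/

namespace RetrievalScheme

variable {V : Type*} {G : SimpleGraph V} {L : ℕ} (T : RetrievalScheme G L)

/-- The answer of server `i` to the query `q` if `w` is the tuple of all files. -/
def reply (i : V) (q : T.Query i) (w : G.edgeSet → BinFile L) : T.Answer i :=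
  T.respond i q fun e => w e.1

/-- Two tuples of files are related if server `i` gives the same answer to the query `q`. -/
def replyKer (i : V) (q : T.Query i) : Setoid (G.edgeSet → BinFile L) := Setoid.ker (T.reply i q)

theorem reply_congr (i : V) (q : T.Query i) {w w' : G.edgeSet → BinFile L}
    (h : ∀ e : G.edgeSet, i ∈ (e : Sym2 V) → w e = w' e) : T.reply i q w = T.reply i q w' := by
  unfold reply
  congr 1
  ext1 e
  exact h e.1 e.2

section Laws

variable [Fintype (G.edgeSet → BinFile L)]

theorem map_file : T.P.map T.file = PMF.uniformOfFintype (G.edgeSet → BinFile L) := by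
  ext w
  rw [T.file_uniform, PMF.uniformOfFintype_apply, Nat.card_eq_fintype_card]

theorem map_file_query (θ : G.edgeSet) :
    T.P.map (fun ω => (T.file ω, fun i => T.query θ i ω)) =
      (PMF.uniformOfFintype (G.edgeSet → BinFile L)).bind fun w =>
        (T.P.map fun ω i => T.query θ i ω).map (Prod.mk w) := by
  ext ⟨w, q⟩
  rw [T.query_indep, bind_map_prodMk_apply, T.map_file]

/-- By independence the files can be redrawn uniformly once the queries are known, which exhibits
the law of the answer as a mixture over the queries. -/
theorem map_answer (θ : G.edgeSet) (i : V) :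
    T.P.map (T.answer θ i) = T.P.bind fun ω =>
      (PMF.uniformOfFintype (G.edgeSet → BinFile L)).map (T.reply i (T.query θ i ω)) := by
  have h := congrArg (PMF.map fun x => T.reply i (x.2 i) x.1) (T.map_file_query θ)
  rw [PMF.map_comp, PMF.map_bind] at h
  simp only [PMF.map_comp] at h
  refine h.trans ?_
  simp only [← PMF.bind_pure_comp]
  rw [PMF.bind_comm]
  rfl

theorem mean_classEntropy_le (θ : G.edgeSet) (i : V) :
    mean T.P (fun ω => ENNReal.ofReal (classEntropy (T.replyKer i (T.query θ i ω)))) ≤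
      entropy (T.P.map (T.answer θ i)) := by
  rw [map_answer]
  refine le_of_eq_of_le ?_ (tsum_mul_entropy_le _ _)
  simp only [entropy_map_uniform]
  rfl

/-- Reliability speaks only of the support; independence shows that queries which can occur do occur
there with every tuple of files. -/
theorem exists_sample {θ : G.edgeSet} {ω : T.Ω} (hω : ω ∈ T.P.support)
    (w : G.edgeSet → BinFile L) :
    ∃ ω' ∈ T.P.support, T.file ω' = w ∧ ∀ i, T.query θ i ω' = T.query θ i ω := by
  have h : (w, fun i => T.query θ i ω) ∈
      (T.P.map fun ω => (T.file ω, fun i => T.query θ i ω)).support := by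
    rw [PMF.mem_support_iff, T.query_indep, mul_ne_zero_iff, ← PMF.mem_support_iff,
      ← PMF.mem_support_iff, map_file]
    exact ⟨PMF.mem_support_uniformOfFintype w, (PMF.mem_support_map_iff _ _ _).2 ⟨ω, hω, rfl⟩⟩
  obtain ⟨ω', hω', h⟩ := (PMF.mem_support_map_iff _ _ _).1 h
  exact ⟨ω', hω', (Prod.ext_iff.1 h).1, fun i => congrFun (Prod.ext_iff.1 h).2 i⟩

end Laws

variable {T}

theorem IsPrivate.mean_query_eq (hT : T.IsPrivate) (i : V) (θ θ' : G.edgeSet)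
    (f : T.Query i → ℝ≥0∞) :
    mean T.P (fun ω => f (T.query θ i ω)) = mean T.P (fun ω => f (T.query θ' i ω)) := by
  have h := congrArg (PMF.map Prod.fst) (hT i θ θ')
  simp only [PMF.map_comp, Function.comp_def] at h
  rw [mean, ← tsum_map_mul T.P (T.query θ i) f, h, tsum_map_mul]
  rfl

theorem IsPrivate.map_answer_eq (hT : T.IsPrivate) (i : V) (θ θ' : G.edgeSet) :
    T.P.map (T.answer θ i) = T.P.map (T.answer θ' i) := by
  have h := congrArg (PMF.map fun x => x.2.1) (hT i θ θ')
  simpa only [PMF.map_comp, Function.comp_def] using h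

/-! ### Converse bounds for two and three servers -/

section Converse

variable [Fintype (G.edgeSet → BinFile L)]

theorem IsReliable.file_eq (hT : T.IsReliable) {θ : G.edgeSet} {ω : T.Ω} (hω : ω ∈ T.P.support)
    {w w' : G.edgeSet → BinFile L}
    (h : ∀ i, T.reply i (T.query θ i ω) w = T.reply i (T.query θ i ω) w') : w θ = w' θ := by
  obtain ⟨decode, hd⟩ := hT θ
  have key : ∀ w, decode (fun i => T.query θ i ω) (fun i => T.reply i (T.query θ i ω) w) = w θ := by
    intro w
    obtain ⟨ω', hω', rfl, hq⟩ := T.exists_sample hω w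
    refine Eq.trans (congrArg₂ decode (funext fun i => (hq i).symm) (funext fun i => ?_)) (hd ω' hω')
    rw [← hq]
    rfl
  rw [← key w, ← key w', funext h]

/-- Only `i` and `j` store `θ`, so all other replies are already determined by the remaining files
and decoding goes through. -/
theorem IsReliable.replyKer_inf_agreeOff_eq_bot (hT : T.IsReliable) {i j : V} {θ : G.edgeSet}
    (hθ : (θ : Sym2 V) = s(i, j)) {ω : T.Ω} (hω : ω ∈ T.P.support) :
    T.replyKer i (T.query θ i ω) ⊓ T.replyKer j (T.query θ j ω) ⊓ agreeOff (BinFile L) {θ} =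
      ⊥ := by
  refine le_bot_iff.1 fun w w' ⟨⟨hi, hj⟩, hR⟩ => ?_
  have hR : ∀ e : G.edgeSet, e ≠ θ → w e = w' e := hR
  have hθ' : w θ = w' θ := by
    refine hT.file_eq hω fun k => ?_
    by_cases hki : k = i
    · subst hki; exact hi
    by_cases hkj : k = j
    · subst hkj; exact hj
    refine T.reply_congr _ _ fun e he => hR e ?_
    rintro rfl
    rw [hθ, Sym2.mem_iff] at he
    exact he.elim hki hkj
  change w = w'
  funext e
  by_cases he : e = θ
  · rw [he, hθ']
  · exact hR e he

/-- Servers other than `i, j, k` store neither `e` nor `f`. Hence `e` can be decoded, and `f` is the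
only file possibly still unknown. -/
theorem IsReliable.replyKer_inf_agreeOff_pair_le (hT : T.IsReliable) {i j k : V}
    {e f : G.edgeSet} (he : (e : Sym2 V) = s(i, j)) (hf : (f : Sym2 V) = s(j, k)) {ω : T.Ω}
    (hω : ω ∈ T.P.support) :
    T.replyKer i (T.query e i ω) ⊓ T.replyKer j (T.query e j ω) ⊓ T.replyKer k (T.query e k ω) ⊓
      agreeOff (BinFile L) {e, f} ≤ agreeOff (BinFile L) {f} := by
  rintro w w' ⟨⟨⟨hi, hj⟩, hk⟩, hR⟩
  have hR : ∀ d : G.edgeSet, ¬ (d = e ∨ d = f) → w d = w' d := hR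
  have he' : w e = w' e := by
    refine hT.file_eq hω fun l => ?_
    by_cases hli : l = i
    · subst hli; exact hi
    by_cases hlj : l = j
    · subst hlj; exact hj
    by_cases hlk : l = k
    · subst hlk; exact hk
    refine T.reply_congr _ _ fun d hd => hR d ?_
    rintro (rfl | rfl)
    · rw [he, Sym2.mem_iff] at hd
      exact hd.elim hli hlj
    · rw [hf, Sym2.mem_iff] at hd
      exact hd.elim hlj hlk
  intro d hd
  by_cases hde : d = e
  · rw [hde, he']
  · exact hR d fun h => h.elim hde hd

variable [Finite G.edgeSet]

theorem ambiguity_agreeOff_binFile (S : Set G.edgeSet) :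
    ambiguity (agreeOff (BinFile L) S) = S.ncard * L := by
  rw [ambiguity_agreeOff]
  simp [Real.logb_pow]

theorem IsReliable.le_mean_add_mean (hT : T.IsReliable) {i j : V} {θ : G.edgeSet}
    (hθ : (θ : Sym2 V) = s(i, j)) :
    (L : ℝ≥0∞) ≤
      mean T.P (fun ω => ENNReal.ofReal (classEntropy (T.replyKer i (T.query θ i ω)))) +
      mean T.P (fun ω => ENNReal.ofReal (classEntropy (T.replyKer j (T.query θ j ω)))) := by
  rw [← mean_add, ← mean_const T.P L]
  refine mean_mono _ fun ω hω => ?_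
  rw [← ENNReal.ofReal_add (classEntropy_nonneg _) (classEntropy_nonneg _),
    ← ENNReal.ofReal_natCast]
  refine ENNReal.ofReal_le_ofReal ?_
  have h1 := classEntropy_inf_le (T.replyKer i (T.query θ i ω)) (T.replyKer j (T.query θ j ω))
  have h2 := classEntropy_inf_le (T.replyKer i (T.query θ i ω) ⊓ T.replyKer j (T.query θ j ω))
    (agreeOff (BinFile L) {θ})
  rw [hT.replyKer_inf_agreeOff_eq_bot hθ hω] at h2
  have h3 := classEntropy_bot_sub (agreeOff (BinFile L) {θ})
  rw [ambiguity_agreeOff_binFile, Set.ncard_singleton] at h3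
  push_cast at h3
  linarith

theorem IsReliable.le_entropy_add_entropy (hT : T.IsReliable) (hT' : T.IsPrivate) {i j : V}
    (hij : G.Adj i j) (θ : G.edgeSet) :
    (L : ℝ≥0∞) ≤ entropy (T.P.map (T.answer θ i)) + entropy (T.P.map (T.answer θ j)) := by
  rw [hT'.map_answer_eq i θ ⟨s(i, j), hij⟩, hT'.map_answer_eq j θ ⟨s(i, j), hij⟩]
  exact (hT.le_mean_add_mean rfl).trans
    (add_le_add (T.mean_classEntropy_le _ _) (T.mean_classEntropy_le _ _))

theorem IsReliable.le_two_mul_entropy_add (hT : T.IsReliable) (hT' : T.IsPrivate) {i j k : V}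
    (hij : G.Adj i j) (hjk : G.Adj j k) (hik : i ≠ k) (θ : G.edgeSet) :
    3 * (L : ℝ≥0∞) ≤ 2 * (entropy (T.P.map (T.answer θ i)) + entropy (T.P.map (T.answer θ j)) +
      entropy (T.P.map (T.answer θ k))) := by
  obtain ⟨e, he⟩ : ∃ e : G.edgeSet, (e : Sym2 V) = s(i, j) := ⟨⟨s(i, j), hij⟩, rfl⟩
  obtain ⟨f, hf⟩ : ∃ f : G.edgeSet, (f : Sym2 V) = s(j, k) := ⟨⟨s(j, k), hjk⟩, rfl⟩
  have hef : e ≠ f := by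
    rintro rfl
    rw [he, Sym2.eq_iff] at hf
    rcases hf with ⟨h, -⟩ | ⟨h, -⟩
    · exact hij.ne h
    · exact hik h
  rw [hT'.map_answer_eq i θ e, hT'.map_answer_eq j θ e, hT'.map_answer_eq k θ e]
  set κ := classEntropy (⊥ : Setoid (G.edgeSet → BinFile L))
  set R := agreeOff (BinFile L) {e, f}
  set R' := agreeOff (BinFile L) {f}
  have hR : κ - classEntropy R = 2 * L := by
    rw [classEntropy_bot_sub, ambiguity_agreeOff_binFile, Set.ncard_pair hef]; norm_num
  have hR' : κ - classEntropy R' = L := by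
    rw [classEntropy_bot_sub, ambiguity_agreeOff_binFile, Set.ncard_singleton]; norm_num
  set h : (l : V) → T.Query l → ℝ≥0∞ := fun l q => ENNReal.ofReal (classEntropy (T.replyKer l q))
  set g : (l : V) → T.Query l → ℝ≥0∞ :=
    fun l q => ENNReal.ofReal (classEntropy (T.replyKer l q ⊓ R'))
  -- Here `e` is desired: the three replies and `R` determine `R'`, and subadditivity splits their
  -- joint entropy.
  have upper : ∀ l, l = j ∨ l = k → mean T.P (fun ω => g l (T.query e l ω)) ≤
      mean T.P (fun ω => h i (T.query e i ω)) + mean T.P (fun ω => h j (T.query e j ω)) +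
        mean T.P (fun ω => h k (T.query e k ω)) + ENNReal.ofReal (classEntropy R) := by
    intro l hl
    rw [← mean_const T.P (ENNReal.ofReal (classEntropy R)), ← mean_add, ← mean_add, ← mean_add]
    refine mean_mono _ fun ω hω => ?_
    have h0 := hT.replyKer_inf_agreeOff_pair_le he hf hω
    have h1 : classEntropy (T.replyKer l (T.query e l ω) ⊓ R') ≤
        classEntropy (T.replyKer i (T.query e i ω) ⊓ T.replyKer j (T.query e j ω) ⊓
          T.replyKer k (T.query e k ω) ⊓ R) := by
      refine classEntropy_anti (le_inf ?_ h0)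
      rcases hl with rfl | rfl
      · exact inf_le_left.trans (inf_le_left.trans inf_le_right)
      · exact inf_le_left.trans inf_le_right
    simp only [g, h]
    rw [← ENNReal.ofReal_add, ← ENNReal.ofReal_add, ← ENNReal.ofReal_add]
    · refine ENNReal.ofReal_le_ofReal (h1.trans ((classEntropy_inf_le _ _).trans ?_))
      gcongr
      exact (classEntropy_inf_le _ _).trans (by gcongr; exact classEntropy_inf_le _ _)
    all_goals
      have := fun r : Setoid (G.edgeSet → BinFile L) => classEntropy_nonneg r
      first | exact this _ | exact add_nonneg (this _) (this _) |
        exact add_nonneg (add_nonneg (this _) (this _)) (this _)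
  have lower : ENNReal.ofReal (κ + classEntropy R') ≤
      mean T.P (fun ω => g j (T.query e j ω)) + mean T.P (fun ω => g k (T.query e k ω)) := by
    -- Each mean involves the query to a single server, so privacy allows the desired file to change
    -- from `e` to `f`.
    rw [hT'.mean_query_eq j e f, hT'.mean_query_eq k e f, ← mean_add, ← mean_const T.P (.ofReal _)]
    refine mean_mono _ fun ω hω => ?_
    rw [← ENNReal.ofReal_add (classEntropy_nonneg _) (classEntropy_nonneg _)]
    refine ENNReal.ofReal_le_ofReal ?_
    have h1 := classEntropy_inf_add_le (T.replyKer j (T.query f j ω))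
      (T.replyKer k (T.query f k ω)) R'
    rwa [hT.replyKer_inf_agreeOff_eq_bot hf hω] at h1
  have hle := lower.trans (add_le_add (upper j (.inl rfl)) (upper k (.inr rfl)))
  -- The two upper bounds contribute `2 * classEntropy R`, which is finite and cancels, leaving `3 *
  -- L`.
  have hsplit : κ + classEntropy R' = 3 * L + 2 * classEntropy R := by linarith
  rw [← two_mul, mul_add, hsplit, ENNReal.ofReal_add (by positivity)
    (mul_nonneg zero_le_two (classEntropy_nonneg _)), ENNReal.ofReal_mul zero_le_two,
    ENNReal.ofReal_mul (by norm_num), ENNReal.ofReal_natCast, ENNReal.ofReal_ofNat,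
    ENNReal.ofReal_ofNat, ENNReal.add_le_add_iff_right
      (ENNReal.mul_ne_top ENNReal.ofNat_ne_top ENNReal.ofReal_ne_top)] at hle
  refine hle.trans ?_
  gcongr <;> exact T.mean_classEntropy_le _ _

end Converse

end RetrievalScheme

/-! ### Summation along the path -/

theorem mul_le_two_mul_sum {c : ℝ≥0∞} {a : ℕ → ℝ≥0∞} {N : ℕ} (hN : 2 ≤ N)
    (h₂ : ∀ n, n + 1 < N → c ≤ a n + a (n + 1))
    (h₃ : 3 ≤ N → 3 * c ≤ 2 * (a 0 + a 1 + a 2)) :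
    (N : ℝ≥0∞) * c ≤ 2 * ∑ n ∈ Finset.range N, a n := by
  induction N using Nat.strong_induction_on with
  | _ N ih =>
    match N, hN with
    | 2, _ =>
      simp only [Finset.sum_range_succ, Finset.sum_range_zero, zero_add, Nat.cast_ofNat]
      gcongr
      exact h₂ 0 (by norm_num)
    | 3, _ =>
      simp only [Finset.sum_range_succ, Finset.sum_range_zero, zero_add, Nat.cast_ofNat]
      exact h₃ le_rfl
    | n + 4, _ =>
      have := ih (n + 2) (by omega) (by omega) (fun m hm => h₂ m (by omega))
        (fun _ => h₃ (by omega))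
      rw [Finset.sum_range_succ, Finset.sum_range_succ, add_assoc, mul_add,
        show ((n + 4 : ℕ) : ℝ≥0∞) = (n + 2 : ℕ) + 2 by push_cast; ring, add_mul]
      gcongr
      exact h₂ (n + 2) (by omega)

/-- The entropies are extended by zero to all of `ℕ`; the bounds only involve indices below `N`, so
the default value plays no role. -/
theorem rate_le_of_path {N L : ℕ} (hN : 2 ≤ N)
    {T : RetrievalScheme (SimpleGraph.pathGraph N) L} (hT : T.IsReliable) (hT' : T.IsPrivate)
    (θ : (SimpleGraph.pathGraph N).edgeSet) : T.rate θ ≤ 2 / (N : ℝ≥0∞) := by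
  classical
  have : Fintype ((SimpleGraph.pathGraph N).edgeSet → BinFile L) := Fintype.ofFinite _
  set a : ℕ → ℝ≥0∞ := fun n =>
    if h : n < N then entropy (T.P.map (T.answer θ ⟨n, h⟩)) else 0 with ha
  have hsum : ∑ i, entropy (T.P.map (T.answer θ i)) = ∑ n ∈ Finset.range N, a n := by
    rw [Finset.sum_range]
    exact Finset.sum_congr rfl fun i _ => by simp [ha]
  have key : (N : ℝ≥0∞) * L ≤ 2 * ∑ n ∈ Finset.range N, a n := by
    refine mul_le_two_mul_sum hN (fun n hn => ?_) fun h => ?_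
    · simp only [ha, hn, Nat.lt_of_succ_lt hn, dif_pos]
      exact hT.le_entropy_add_entropy hT' (SimpleGraph.pathGraph_adj.2 (.inl rfl)) θ
    · simp only [ha, show 0 < N by omega, show 1 < N by omega, show 2 < N by omega, dif_pos]
      exact hT.le_two_mul_entropy_add hT' (SimpleGraph.pathGraph_adj.2 (.inl rfl))
        (SimpleGraph.pathGraph_adj.2 (.inl rfl)) (by simp) θ
  have hN0 : (N : ℝ≥0∞) ≠ 0 := by exact_mod_cast (by omega : N ≠ 0)
  rw [RetrievalScheme.rate, hsum]
  refine ENNReal.div_le_of_le_mul ?_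
  rw [← ENNReal.mul_div_right_comm, ENNReal.le_div_iff_mul_le (.inl hN0) (.inl (by simp)),
    mul_comm]
  exact key

/-! ### Product distributions for the scheme's sample space -/

section IndependentPair

variable {α β γ : Type*} (p : PMF α) (q : PMF β)

theorem map_fst_pair : (p.bind fun a => q.map (Prod.mk a)).map Prod.fst = p := by
  simp only [PMF.map_bind, PMF.map_comp]
  change (p.bind fun a => q.map (Function.const β a)) = p
  simp only [PMF.map_const, PMF.bind_pure]

theorem map_comp_snd_pair (g : β → γ) :
    ((p.bind fun a => q.map (Prod.mk a)).map fun x => g x.2) = q.map g := by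
  simp only [PMF.map_bind, PMF.map_comp]
  exact PMF.bind_const p (q.map g)

theorem map_pair (g : β → γ) :
    ((p.bind fun a => q.map (Prod.mk a)).map fun x => (x.1, g x.2)) =
      p.bind fun a => (q.map g).map (Prod.mk a) := by
  simp only [PMF.map_bind, PMF.map_comp]
  rfl

theorem map_pair_apply (g : β → γ) (a : α) (c : γ) :
    ((p.bind fun a => q.map (Prod.mk a)).map fun x => (x.1, g x.2)) (a, c) =
      (p.bind fun a => q.map (Prod.mk a)).map Prod.fst a *
        ((p.bind fun a => q.map (Prod.mk a)).map fun x => g x.2) c := by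
  rw [map_pair, bind_map_prodMk_apply, map_fst_pair, map_comp_snd_pair]

theorem map_pair_equiv [Fintype β] [Nonempty β] (e : β ≃ β) :
    ((p.bind fun a => (PMF.uniformOfFintype β).map (Prod.mk a)).map fun x => (x.1, e x.2)) =
      p.bind fun a => (PMF.uniformOfFintype β).map (Prod.mk a) := by
  rw [map_pair, uniformOfFintype_map_equiv]

end IndependentPair

/-! ### The two-bit scheme attaining the bound -/

section Scheme

variable {N : ℕ}

/-- The offset of the index that server `i` is asked for: it is `1` if `i` is the larger endpoint
of the edge `e = θ` and `0` otherwise. -/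
noncomputable def indexShift (θ : (SimpleGraph.pathGraph N).edgeSet) (i : Fin N)
    (e : (SimpleGraph.pathGraph N).edgeSet) : Fin 2 :=
  open Classical in if e = θ ∧ ∃ j ∈ (e : Sym2 (Fin N)), j < i then 1 else 0

open Classical in
/-- The scheme for the path in which every server returns the sum of one bit of each of its files.
The two servers of a file are asked for the same random position of the file, except that they are
asked for different positions of the desired file. -/
noncomputable def pathScheme (N : ℕ) : RetrievalScheme (SimpleGraph.pathGraph N) 2 where
  Ω := ((SimpleGraph.pathGraph N).edgeSet → BinFile 2) × ((SimpleGraph.pathGraph N).edgeSet → Fin 2)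
  P := (PMF.uniformOfFintype _).bind fun w => (PMF.uniformOfFintype _).map (Prod.mk w)
  file := Prod.fst
  file_uniform w := by
    rw [map_fst_pair, PMF.uniformOfFintype_apply, Nat.card_eq_fintype_card]
  Query i := {e : (SimpleGraph.pathGraph N).edgeSet // i ∈ (e : Sym2 (Fin N))} → Fin 2
  query θ i ω e := ω.2 e.1 + indexShift θ i e.1
  query_indep θ w q := map_pair_apply _ _ (fun (h : (SimpleGraph.pathGraph N).edgeSet → Fin 2) i
    (e : {e : (SimpleGraph.pathGraph N).edgeSet // i ∈ (e : Sym2 (Fin N))}) =>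
      h e.1 + indexShift θ i e.1) w q
  Answer _ := ZMod 2
  respond _ q s := ∑ e, s e (q e)

theorem pathScheme_isPrivate : (pathScheme N).IsPrivate := by
  classical
  -- For a single server the shift merely translates the uniform positions, so the joint law equals
  -- the unshifted one, in which `θ` does not appear.
  have key : ∀ (i : Fin N) (θ : (SimpleGraph.pathGraph N).edgeSet),
      (pathScheme N).P.map (fun ω => ((pathScheme N).query θ i ω, (pathScheme N).answer θ i ω,
        (pathScheme N).stored i ω)) =
      (pathScheme N).P.map (fun ω => ((fun e => ω.2 e.1 : (pathScheme N).Query i),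
        (pathScheme N).respond i (fun e => ω.2 e.1) ((pathScheme N).stored i ω),
        (pathScheme N).stored i ω)) := by
    intro i θ
    have h := congrArg (PMF.map fun ω : (pathScheme N).Ω =>
        ((fun e => ω.2 e.1 : (pathScheme N).Query i),
        (pathScheme N).respond i (fun e => ω.2 e.1) ((pathScheme N).stored i ω),
        (pathScheme N).stored i ω))
      (map_pair_equiv (PMF.uniformOfFintype ((SimpleGraph.pathGraph N).edgeSet → BinFile 2))
        (Equiv.addRight (indexShift θ i)))
    exact (PMF.map_comp _ _ _).symm.trans h
  intro i θ θ'
  rw [key, key]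

theorem exists_eq_edge (e : (SimpleGraph.pathGraph N).edgeSet) :
    ∃ a b : Fin N, (e : Sym2 (Fin N)) = s(a, b) ∧ (a : ℕ) + 1 = b := by
  obtain ⟨e, he⟩ := e
  induction e with
  | _ a b =>
    rcases SimpleGraph.pathGraph_adj.1 he with h | h
    · exact ⟨a, b, rfl, h⟩
    · exact ⟨b, a, Sym2.eq_swap, h⟩

open Classical in
theorem sum_ite_mem_edge {M : Type*} [AddCommMonoid M] {a b : Fin N} (hab : a ≠ b)
    (g : Fin N → M) : ∑ i, (if i ∈ s(a, b) then g i else 0) = g a + g b := by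
  rw [← Finset.sum_filter, ← Finset.sum_pair hab]
  congr 1
  ext i
  simp

open Classical in
/-- The sum of the answers on one side of a cut whose only edge is `θ`. -/
theorem sum_answer_of_cut (θ : (SimpleGraph.pathGraph N).edgeSet) {x y : Fin N}
    (hθ : (θ : Sym2 (Fin N)) = s(x, y)) (p : Fin N → Prop) [DecidablePred p] (hx : p x) (hy : ¬ p y)
    (hp : ∀ c d : Fin N, (c : ℕ) + 1 = d → s(c, d) ≠ (θ : Sym2 (Fin N)) → (p c ↔ p d))
    (w : (SimpleGraph.pathGraph N).edgeSet → BinFile 2)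
    (h : (SimpleGraph.pathGraph N).edgeSet → Fin 2) :
    ∑ i, (if p i then ∑ e : {e : (SimpleGraph.pathGraph N).edgeSet // i ∈ (e : Sym2 (Fin N))},
      w e.1 (h e.1 + indexShift θ i e.1) else 0) = w θ (h θ + indexShift θ x θ) := by
  have hans : ∀ i, (∑ e : {e : (SimpleGraph.pathGraph N).edgeSet // i ∈ (e : Sym2 (Fin N))},
      w e.1 (h e.1 + indexShift θ i e.1)) = ∑ e : (SimpleGraph.pathGraph N).edgeSet,
        if i ∈ (e : Sym2 (Fin N)) then w e (h e + indexShift θ i e) else 0 := by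
    intro i
    rw [← Finset.sum_filter]
    exact (Finset.sum_subtype
      (p := fun e : (SimpleGraph.pathGraph N).edgeSet => i ∈ (e : Sym2 (Fin N)))
      (Finset.univ.filter fun e : (SimpleGraph.pathGraph N).edgeSet => i ∈ (e : Sym2 (Fin N)))
      (fun e => by simp) fun e => w e (h e + indexShift θ i e)).symm
  have hswap : ∑ i, (if p i then ∑ e : {e : (SimpleGraph.pathGraph N).edgeSet //
        i ∈ (e : Sym2 (Fin N))}, w e.1 (h e.1 + indexShift θ i e.1) else 0) =
      ∑ e : (SimpleGraph.pathGraph N).edgeSet, ∑ i, if i ∈ (e : Sym2 (Fin N)) then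
        (if p i then w e (h e + indexShift θ i e) else 0) else 0 := by
    rw [Finset.sum_comm]
    refine Finset.sum_congr rfl fun i _ => ?_
    rw [hans]
    by_cases h : p i
    · simp only [if_pos h]
    · simp only [if_neg h, ite_self, Finset.sum_const_zero]
  -- An edge other than `θ` has both ends on one side of the cut and shift zero at both, so its bit
  -- occurs twice or not at all. The edge `θ` is counted once, at `x`.
  rw [hswap, Finset.sum_eq_single θ]
  · have hxy : x ≠ y := fun h => hy (h ▸ hx)
    rw [hθ, sum_ite_mem_edge hxy, if_pos hx, if_neg hy, add_zero]
  · intro e _ he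
    obtain ⟨c, d, hcd, hcd'⟩ := exists_eq_edge e
    have hne : c ≠ d := by rintro rfl; omega
    have hs : ∀ i, indexShift θ i e = 0 := fun i => if_neg fun h => he h.1
    have hiff := hp c d hcd' fun h' => he (Subtype.ext (hcd.trans h'))
    simp only [hs]
    rw [hcd, sum_ite_mem_edge hne]
    simp only [hiff]
    exact CharTwo.add_self_eq_zero _
  · simp

theorem pathScheme_isReliable : (pathScheme N).IsReliable := by
  classical
  intro θ
  obtain ⟨a, b, hθ, hab⟩ := exists_eq_edge θ
  have ha : a ∈ (θ : Sym2 (Fin N)) := by simp [hθ]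
  -- The left side reveals the bit at the position asked of `a`; the right side reveals the other
  -- one.
  refine ⟨fun q A x => if x = q a ⟨θ, ha⟩ then ∑ i, (if i ≤ a then (A i : ZMod 2) else 0) else
    ∑ i, (if ¬ i ≤ a then (A i : ZMod 2) else 0), fun ω _ => ?_⟩
  have hcut : ∀ c d : Fin N, (c : ℕ) + 1 = d → s(c, d) ≠ (θ : Sym2 (Fin N)) →
      (c ≤ a ↔ d ≤ a) := by
    intro c d hcd hne
    have : c ≠ a := by
      rintro rfl
      have : d = b := Fin.ext (hcd.symm.trans hab)
      exact hne (by rw [hθ, this])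
    rw [Fin.le_def, Fin.le_def]
    have := Fin.val_ne_of_ne this
    omega
  have hb : ¬ b ≤ a := by rw [Fin.le_def]; omega
  have hsa : indexShift θ a θ = 0 := by
    refine if_neg ?_
    rintro ⟨-, j, hj, hja⟩
    rw [hθ, Sym2.mem_iff] at hj
    rcases hj with rfl | rfl
    · exact lt_irrefl _ hja
    · exact hb hja.le
  have hsb : indexShift θ b θ = 1 := if_pos ⟨rfl, a, ha, not_le.1 hb⟩
  have hleft := sum_answer_of_cut θ hθ (fun i => i ≤ a) le_rfl hb hcut ω.1 ω.2
  have hright := sum_answer_of_cut θ (hθ.trans Sym2.eq_swap) (fun i => ¬ i ≤ a) hb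
    (fun h => h le_rfl) (fun c d h h' => not_congr (hcut c d h h')) ω.1 ω.2
  rw [hsa, add_zero] at hleft
  rw [hsb] at hright
  funext x
  have hq : (pathScheme N).query θ a ω ⟨θ, ha⟩ = ω.2 θ := by
    change ω.2 θ + indexShift θ a θ = _
    rw [hsa, add_zero]
  change (if x = (pathScheme N).query θ a ω ⟨θ, ha⟩ then _ else _) = ω.1 θ x
  rw [hq]
  split_ifs with h
  · exact hleft.trans (by rw [h])
  · refine hright.trans (congrArg _ ?_)
    -- In `Fin 2`, a position different from `y` is `y + 1`.
    revert h
    generalize ω.2 θ = y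
    revert x y
    decide

/-- Each answer is a single bit. An inequality suffices, since the converse supplies the opposite
bound and the exact entropies are not needed. -/
theorem le_rate_pathScheme (θ : (SimpleGraph.pathGraph N).edgeSet) :
    2 / (N : ℝ≥0∞) ≤ (pathScheme N).rate θ := by
  rw [RetrievalScheme.rate, Nat.cast_ofNat]
  refine ENNReal.div_le_div_left ?_ _
  calc ∑ i, entropy ((pathScheme N).P.map ((pathScheme N).answer θ i))
      ≤ ∑ _i : Fin N, (1 : ℝ≥0∞) := Finset.sum_le_sum fun i _ => entropy_le_one _
    _ = N := by simp

end Scheme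

end GraphPIR

theorem mainTheorem1 (N : ℕ) (hN : 2 ≤ N) :
    GraphPIR.capacity (SimpleGraph.pathGraph N) = 2 / (N : ℝ≥0∞) ∧
      ∃ T : GraphPIR.RetrievalScheme (SimpleGraph.pathGraph N) 2,
        T.IsReliable ∧ T.IsPrivate ∧ ∀ θ, T.rate θ = 2 / (N : ℝ≥0∞) := by
  have hrel := GraphPIR.pathScheme_isReliable (N := N)
  have hpriv := GraphPIR.pathScheme_isPrivate (N := N)
  have hrate : ∀ θ, (GraphPIR.pathScheme N).rate θ = 2 / (N : ℝ≥0∞) := fun θ =>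
    (GraphPIR.rate_le_of_path hN hrel hpriv θ).antisymm (GraphPIR.le_rate_pathScheme θ)
  refine ⟨le_antisymm ?_ ?_, GraphPIR.pathScheme N, hrel, hpriv, hrate⟩
  · exact iSup_le fun L => iSup_le fun _ => iSup_le fun T => iSup_le fun hT => iSup_le fun hT' =>
      iSup_le fun θ => GraphPIR.rate_le_of_path hN hT hT' θ
  · obtain ⟨θ⟩ : Nonempty (SimpleGraph.pathGraph N).edgeSet :=
      ⟨⟨s(⟨0, by omega⟩, ⟨1, by omega⟩), SimpleGraph.pathGraph_adj.2 (.inl rfl)⟩⟩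
    rw [← hrate θ]
    exact le_iSup_of_le 2 (le_iSup_of_le one_le_two (le_iSup_of_le _ (le_iSup_of_le hrel
      (le_iSup_of_le hpriv (le_iSup_of_le θ le_rfl)))))
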